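/- \textbf{Setting.} Let $\mathbb{T}\subseteq\mathbb{R}$ be closed, let $a,b\in\mathbb{T}$ with $a<b$, and let $I=[a,b]\cap\mathbb{T}$, regarded as a time scale of its own. On $I$ let $\sigma(t)=\inf\{s\in I: s>t\}$ (with $\sigma(b)=b$) and $\rho(t)=\sup\{s\in I: s<t\}$ (with $\rho(a)=a$). Let $I_\kappa=I\setminus\{a\}$ if $\sigma(a)>a$, and $I_\kappa=I$ otherwise. A number $d$ is the nabla derivative $g^\nabla(t)$ of $g:I\to\mathbb{R}$ at $t\in I_\kappa$ if for every $\varepsilon>0$ there is a neighbourhood $U$ of $t$ in $I$ with $|g(\rho(t))-g(s)-d(\rho(t)-s)|\le\varepsilon|\rho(t)-s|$ for all $s\in U$. A function is ld-continuous if it is continuous at the left-dense points ($\rho(t)=t$) and has finite right-sided limits at the right-dense points ($\sigma(t)=t$). $C^1_{ld}(I)$ is the set of functions $x:I\to\mathbb{R}$ that are nabla differentiable on $I_\kappa$ with ld-continuous $x^\nabla:I_\kappa\to\mathbb{R}$; put $x^\rho=x\circ\rho$ and $\|x\|_1=\sup_{I}|x^\rho|+\sup_{I_\kappa}|x^\nabla|$.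 The nabla integral of $g$ over $[a,c]$, for $c\in I$, is $\int_a^c g(t)\,\nabla t=\int_{(a,c]} g(\inf\{t\in I: t\ge s\})\,ds$ (Lebesgue integral on the right). Let $f_1,f_2:I_\kappa\times\mathbb{R}^2\to\mathbb{R}$, $(t,y,v)\mapsto f_i(t,y,v)$, be such that, for $i=1,2$: the partial derivatives $f_{iy},f_{iv}$ with respect to $y$ and $v$ exist and are continuous in $(y,v)$ for each $t\in I_\kappa$; they are bounded on $I_\kappa\times K$ for every bounded $K\subset\mathbb{R}^2$; and for every $x\in C^1_{ld}(I)$ the functions $t\mapsto f_i(t,x^\rho(t),x^\nabla(t))$, $t\mapsto f_{iy}(t,x^\rho(t),x^\nabla(t))$, $t\mapsto f_{iv}(t,x^\rho(t),x^\nabla(t))$ are ld-continuous on $I_\kappa$. Put $\mathcal{F}_i[x]=\int_a^b f_i(t,x^\rho(t),x^\nabla(t))\,\nabla t$. Consider the problem of minimizing or maximizing $$\mathcal{L}[x]=\frac{\mathcal{F}_1[x]}{\mathcal{F}_2[x]}\qquad (x(a)=x_a)\quad (x(b)=x_b),$$ where each of the two end-point conditions may or may not be present. The admissible functions are the $x\in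 C^1_{ld}(I)$ that satisfy the end-point conditions which are present and have $\mathcal{F}_2[x]\ne0$. \textbf{Statement.} Let $\tilde x$ be a weak local solution: $\tilde x$ is admissible, and there is $\delta>0$ such that either $\mathcal{L}[\tilde x]\le\mathcal{L}[x]$ for all admissible $x$ with $\|x-\tilde x\|_1<\delta$, or $\mathcal{L}[\tilde x]\ge\mathcal{L}[x]$ for all such $x$. Let $Q=\mathcal{F}_1[\tilde x]/\mathcal{F}_2[\tilde x]$, and write $g[t]=g(t,\tilde x^\rho(t),\tilde x^\nabla(t))$ for $g=f_{iy},f_{iv}$ and $t\in I_\kappa$. Then: (1) (Euler--Lagrange equation) there is a function $\varphi:I\to\mathbb{R}$ with $\varphi(t)=f_{1v}[t]-Q f_{2v}[t]$ for $t\in I_\kappa$ that is nabla differentiable on $I_\kappa$ and satisfies $$\varphi^\nabla(t)-\bigl(f_{1y}[t]-Q f_{2y}[t]\bigr)=0\qquad\text{for all } t\in I_\kappa .$$ That is, $f_{1v}^\nabla[t]-f_{1y}[t]-Q\bigl(f_{2v}^\nabla[t]-f_{2y}[t]\bigr)=0$, the derivative being taken of the combination $f_{1v}-Qf_{2v}$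 along $\tilde x$. (If $a$ is right-dense, $I_\kappa=I$ and $\varphi$ is this combination; if $a$ is right-scattered, $\tilde x^\nabla(a)$ is not defined and $\varphi(a)$, which enters only the equation at $t=\sigma(a)$, is a suitable number.) (2) If $x(a)$ is not specified, then $$\int_a^{\sigma(a)} f_{1y}[t]\,\nabla t-f_{1v}[\sigma(a)]-Q\left(\int_a^{\sigma(a)} f_{2y}[t]\,\nabla t-f_{2v}[\sigma(a)]\right)=0 .$$ (3) If $x(b)$ is not specified, then $f_{1v}[b]-Q f_{2v}[b]=0$. -/

import Mathlib

open Set Filter Topology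

noncomputable section

namespace TimeScale

/-- Forward jump operator `σ` of the time scale `T`; `σ (max T) = max T`. -/
def sigma (T : Set ℝ) (t : ℝ) : ℝ :=
  open Classical in if (T ∩ Ioi t).Nonempty then sInf (T ∩ Ioi t) else t

/-- Backward jump operator `ρ` of the time scale `T`; `ρ (min T) = min T`. -/
def rho (T : Set ℝ) (t : ℝ) : ℝ :=
  open Classical in if (T ∩ Iio t).Nonempty then sSup (T ∩ Iio t) else t

/-- `T_κ`: the time scale `T` without its minimum if that minimum is right-scattered. -/
def kappa (T : Set ℝ) : Set ℝ :=
  {t | t ∈ T ∧ ¬ (IsLeast T t ∧ t < sigma T t)}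

/-- `d` is a nabla derivative at `t` of `f`, as a function on the time scale `T`. -/
def HasNablaDerivAt (T : Set ℝ) (f : ℝ → ℝ) (d t : ℝ) : Prop :=
  ∀ ε : ℝ, 0 < ε → ∀ᶠ s in 𝓝[T] t,
    |f (rho T t) - f s - d * (rho T t - s)| ≤ ε * |rho T t - s|

/-- The nabla derivative `f^∇ (t)`, with value `0` where there is none. -/
def nablaDeriv (T : Set ℝ) (f : ℝ → ℝ) (t : ℝ) : ℝ :=
  open Classical in if h : ∃ d, HasNablaDerivAt T f d t then h.choose else 0

/-- `g`, as a function on the subset `S` of the time scale `T`, is ld-continuous: continuous at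
the left-dense points of `T`, with finite right-sided limits at the right-dense points of `T`. -/
def LdContinuousOn (T S : Set ℝ) (g : ℝ → ℝ) : Prop :=
  ∀ t ∈ S, (rho T t = t → ContinuousWithinAt g S t) ∧
    (sigma T t = t → ∃ l : ℝ, Tendsto g (𝓝[S ∩ Ioi t] t) (𝓝 l))

/-- `x ∈ C¹_ld (T)`: nabla differentiable on `T_κ` with ld-continuous nabla derivative. -/
def IsC1ld (T : Set ℝ) (x : ℝ → ℝ) : Prop :=
  (∀ t ∈ kappa T, ∃ d, HasNablaDerivAt T x d t) ∧ LdContinuousOn T (kappa T) (nablaDeriv T x)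

/-- The norm `‖x‖₁ = sup |x^ρ| + sup |x^∇|` of `C¹_ld (T)`, for a compact time scale `T`; the
second supremum runs over `T_κ`, where the nabla derivative is defined. -/
def normC1 (T : Set ℝ) (x : ℝ → ℝ) : ℝ :=
  sSup ((fun t => |x (rho T t)|) '' T) + sSup ((fun t => |nablaDeriv T x t|) '' kappa T)

/-- The (Lebesgue) nabla integral `∫_a^b g(t) ∇t` for `a, b ∈ T`: the integral of `g` with respect
to the image of Lebesgue measure on `(a, b]` under the map which fixes the points of `T` and sends
a gap `(ρ(t), t)` to its right end point `t`. Thus a left-scattered point `t` has mass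
`t - ρ(t)`, and `(c, d] ∩ T` has mass `d - c` for all `c ≤ d` in `T ∩ [a, b]`. -/
def nablaIntegral (T : Set ℝ) (g : ℝ → ℝ) (a b : ℝ) : ℝ :=
  ∫ s in a..b, g (sInf (T ∩ Ici s))

/-- The partial derivative `f_y` of `(t, y, v) ↦ f t y v`. -/
def partialY (f : ℝ → ℝ → ℝ → ℝ) (t y v : ℝ) : ℝ := deriv (fun z => f t z v) y

/-- The partial derivative `f_v` of `(t, y, v) ↦ f t y v`. -/
def partialV (f : ℝ → ℝ → ℝ → ℝ) (t y v : ℝ) : ℝ := deriv (fun w => f t y w) v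

/-- The function `t ↦ f (t, x^ρ (t), x^∇ (t))`. -/
def along (T : Set ℝ) (f : ℝ → ℝ → ℝ → ℝ) (x : ℝ → ℝ) (t : ℝ) : ℝ :=
  f t (x (rho T t)) (nablaDeriv T x t)

/-- The nabla functional `𝓕[x] = ∫_a^b f (t, x^ρ (t), x^∇ (t)) ∇t`. -/
def functional (T : Set ℝ) (a b : ℝ) (f : ℝ → ℝ → ℝ → ℝ) (x : ℝ → ℝ) : ℝ :=
  nablaIntegral T (along T f x) a b

/-- The regularity of the integrands: partial derivatives in `y` and `v` which are continuous in
`(y, v)` and bounded on bounded sets, and ld-continuity in `t` of `f`, `f_y`, `f_v` along every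
`x ∈ C¹_ld (T)`. -/
structure IsLagrangian (T : Set ℝ) (f : ℝ → ℝ → ℝ → ℝ) : Prop where
  differentiable_y : ∀ t ∈ kappa T, ∀ v, Differentiable ℝ (fun y => f t y v)
  differentiable_v : ∀ t ∈ kappa T, ∀ y, Differentiable ℝ (fun v => f t y v)
  continuous_y : ∀ t ∈ kappa T, Continuous (fun p : ℝ × ℝ => partialY f t p.1 p.2)
  continuous_v : ∀ t ∈ kappa T, Continuous (fun p : ℝ × ℝ => partialV f t p.1 p.2)
  bounded : ∀ R : ℝ, ∃ C : ℝ, ∀ t ∈ kappa T, ∀ y v : ℝ, |y| ≤ R → |v| ≤ R →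
    |partialY f t y v| ≤ C ∧ |partialV f t y v| ≤ C
  ldContinuous : ∀ x, IsC1ld T x → LdContinuousOn T (kappa T) (along T f x)
  ldContinuous_y : ∀ x, IsC1ld T x → LdContinuousOn T (kappa T) (along T (partialY f) x)
  ldContinuous_v : ∀ x, IsC1ld T x → LdContinuousOn T (kappa T) (along T (partialV f) x)

/-- The admissible functions of the quotient problem: the `x ∈ C¹_ld (T)` which satisfy those of
the conditions `x(a) = x_a`, `x(b) = x_b` that are present (`none` stands for a free end point)
and at which the denominator does not vanish. -/
def quotientAdmissible (T : Set ℝ) (a b : ℝ) (f₂ : ℝ → ℝ → ℝ → ℝ) (xa xb : Option ℝ) :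
    Set (ℝ → ℝ) :=
  {x | IsC1ld T x ∧ (∀ c ∈ xa, x a = c) ∧ (∀ c ∈ xb, x b = c) ∧ functional T a b f₂ x ≠ 0}

/-- `x₀` is a weak local minimizer of `L` among the functions in `adm`. -/
def IsWeakLocalMinimizer (T : Set ℝ) (adm : Set (ℝ → ℝ)) (L : (ℝ → ℝ) → ℝ) (x₀ : ℝ → ℝ) : Prop :=
  x₀ ∈ adm ∧ ∃ δ : ℝ, 0 < δ ∧ ∀ x ∈ adm, normC1 T (x - x₀) < δ → L x₀ ≤ L x

/-- `x₀` is a weak local maximizer of `L` among the functions in `adm`. -/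
def IsWeakLocalMaximizer (T : Set ℝ) (adm : Set (ℝ → ℝ)) (L : (ℝ → ℝ) → ℝ) (x₀ : ℝ → ℝ) : Prop :=
  x₀ ∈ adm ∧ ∃ δ : ℝ, 0 < δ ∧ ∀ x ∈ adm, normC1 T (x - x₀) < δ → L x ≤ L x₀

end TimeScale

end

/-! Along a line `x₀ + ε η` of admissible variations the quotient is a differentiable function of
`ε` with a local extremum at `0`. Since the denominator is nonzero there, the quotient rule says
exactly that the first variation of `𝓕₁ - Q 𝓕₂`, with `Q` frozen, vanishes (`variation_eq_zero`).
With `h = f₁ᵧ - Q f₂ᵧ` and `φ = f₁ᵥ - Q f₂ᵥ` along `x₀` this reads `∫ (h η^ρ + φ η^∇) ∇t = 0`.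

The rest is the Dubois-Reymond argument (`dubois_reymond`). With `H(t) = ∫_a^t h ∇s`, integration by
parts turns the condition into `∫ (φ - H) η^∇ ∇t = -H(b) η(b)`. A variation whose derivative is `φ -
H` minus its mean forces `φ = H + c` on `I_κ`, which is the Euler-Lagrange equation in integrated
form. Affine variations then give `c = 0` if `a` is free and `H(b) + c = 0` if `b` is free.

The calculus behind this rests on writing the nabla integral as a Lebesgue integral of `g ∘ ceilPt`.
Primitives of ld-continuous functions have the expected nabla derivative at every point of `T_κ`,
and a vanishing nabla derivative forces a function to be constant. -/

noncomputable section

namespace TimeScale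

/-! ### Jump operators and the map `ceilPt` on a compact time scale. -/

section

/-- `T` is a compact time scale with minimum `a` and maximum `b > a`. -/
structure SpansInterval (T : Set ℝ) (a b : ℝ) : Prop where
  isClosed : IsClosed T
  isLeast : IsLeast T a
  isGreatest : IsGreatest T b
  lt : a < b

/-- The smallest point of the time scale `T` which is at least `s`. -/
def ceilPt (T : Set ℝ) (s : ℝ) : ℝ := sInf (T ∩ Ici s)

variable {T : Set ℝ} {a b s t c : ℝ}

theorem rho_le (T : Set ℝ) (t : ℝ) : rho T t ≤ t := by
  unfold rho
  split_ifs with h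
  · exact csSup_le h fun s hs => hs.2.le
  · exact le_rfl

theorem le_rho (hs : s ∈ T) (hst : s < t) : s ≤ rho T t := by
  have h : (T ∩ Iio t).Nonempty := ⟨s, hs, hst⟩
  rw [rho, if_pos h]
  exact le_csSup ⟨t, fun u hu => hu.2.le⟩ ⟨hs, hst⟩

theorem rho_mem (hT : IsClosed T) (ht : t ∈ T) : rho T t ∈ T := by
  unfold rho
  split_ifs with h
  · have := csSup_mem_closure h ⟨t, fun u hu => hu.2.le⟩
    exact hT.closure_subset_iff.2 inter_subset_left this
  · exact ht

theorem le_sigma (T : Set ℝ) (t : ℝ) : t ≤ sigma T t := by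
  unfold sigma
  split_ifs with h
  · exact le_csInf h fun s hs => hs.2.le
  · exact le_rfl

theorem sigma_le (hs : s ∈ T) (hts : t < s) : sigma T t ≤ s := by
  have h : (T ∩ Ioi t).Nonempty := ⟨s, hs, hts⟩
  rw [sigma, if_pos h]
  exact csInf_le ⟨t, fun u hu => hu.2.le⟩ ⟨hs, hts⟩

theorem sigma_mem (hT : IsClosed T) (ht : t ∈ T) : sigma T t ∈ T := by
  unfold sigma
  split_ifs with h
  · have := csInf_mem_closure h ⟨t, fun u hu => hu.2.le⟩
    exact hT.closure_subset_iff.2 inter_subset_left this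
  · exact ht

theorem kappa_subset : kappa T ⊆ T := fun _ h => h.1

namespace SpansInterval

theorem isCompact (hT : SpansInterval T a b) : IsCompact T :=
  isCompact_Icc.of_isClosed_subset hT.isClosed fun _ ht => ⟨hT.isLeast.2 ht, hT.isGreatest.2 ht⟩

theorem exists_mem_Ioo_of_rho_eq (hT : SpansInterval T a b) (hat : a < t) (h : rho T t = t)
    (hc : c < t) : ∃ s ∈ T, c < s ∧ s < t := by
  have hne : (T ∩ Iio t).Nonempty := ⟨a, hT.isLeast.1, hat⟩
  rw [rho, if_pos hne] at h
  obtain ⟨s, hs, hcs⟩ := exists_lt_of_lt_csSup hne (h.symm ▸ hc)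
  exact ⟨s, hs.1, hcs, hs.2⟩

theorem exists_mem_Ioo_of_sigma_eq (hT : SpansInterval T a b) (htb : t < b) (h : sigma T t = t)
    (hc : t < c) : ∃ s ∈ T, t < s ∧ s < c := by
  have hne : (T ∩ Ioi t).Nonempty := ⟨b, hT.isGreatest.1, htb⟩
  rw [sigma, if_pos hne] at h
  obtain ⟨s, hs, hcs⟩ := exists_lt_of_csInf_lt hne (h.symm ▸ hc)
  exact ⟨s, hs.1, hs.2, hcs⟩

theorem mem_kappa_iff (hT : SpansInterval T a b) :
    t ∈ kappa T ↔ t ∈ T ∧ (a < t ∨ t = a ∧ sigma T a = a) := by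
  refine ⟨fun h => ⟨h.1, ?_⟩, fun h => ⟨h.1, fun h' => ?_⟩⟩
  · rcases (hT.isLeast.2 h.1).lt_or_eq with h' | h'
    · exact Or.inl h'
    · subst h'
      have := fun h'' => h.2 ⟨hT.isLeast, h''⟩
      exact Or.inr ⟨rfl, le_antisymm (not_lt.1 this) (le_sigma T a)⟩
  · have hta := h'.1.unique hT.isLeast
    subst hta
    rcases h.2 with h2 | h2
    · exact lt_irrefl _ h2
    · exact h'.2.ne' h2.2

theorem mem_kappa_of_lt (hT : SpansInterval T a b) (ht : t ∈ T) (hat : a < t) : t ∈ kappa T :=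
  hT.mem_kappa_iff.2 ⟨ht, Or.inl hat⟩

theorem ceilPt_mem (hT : SpansInterval T a b) (hs : s ≤ b) : ceilPt T s ∈ T := by
  have := csInf_mem_closure (s := T ∩ Ici s) ⟨b, hT.isGreatest.1, hs⟩ ⟨s, fun u hu => hu.2⟩
  exact hT.isClosed.closure_subset_iff.2 inter_subset_left this

theorem le_ceilPt (hT : SpansInterval T a b) (hs : s ≤ b) : s ≤ ceilPt T s :=
  le_csInf ⟨b, hT.isGreatest.1, hs⟩ fun _ hu => hu.2

theorem ceilPt_mem_kappa (hT : SpansInterval T a b) (hs : s ∈ Ioc a b) : ceilPt T s ∈ kappa T :=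
  hT.mem_kappa_of_lt (hT.ceilPt_mem hs.2) (hs.1.trans_le (hT.le_ceilPt hs.2))

end SpansInterval

theorem ceilPt_le (ht : t ∈ T) (hst : s ≤ t) : ceilPt T s ≤ t :=
  csInf_le ⟨s, fun _ hu => hu.2⟩ ⟨ht, hst⟩

namespace SpansInterval

theorem ceilPt_eq_of_mem_Ioc (hT : SpansInterval T a b) (ht : t ∈ T) (hs : s ∈ Ioc (rho T t) t) :
    ceilPt T s = t := by
  have hsb : s ≤ b := hs.2.trans (hT.isGreatest.2 ht)
  refine le_antisymm (ceilPt_le ht hs.2) (not_lt.1 fun h => ?_)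
  have := le_rho (hT.ceilPt_mem hsb) h
  exact absurd (hs.1.trans_le (hT.le_ceilPt hsb)) (not_lt.2 this)

end SpansInterval

end

/-! ### Ld-continuous functions: algebra, boundedness, integrability. -/

section

variable {T S : Set ℝ} {a b s t c : ℝ} {g h : ℝ → ℝ}

theorem LdContinuousOn.congr (hg : LdContinuousOn T S g) (h' : ∀ t ∈ S, h t = g t) :
    LdContinuousOn T S h := fun t ht =>
  ⟨fun hr => ((hg t ht).1 hr).congr h' (h' t ht), fun hr => by
    obtain ⟨l, hl⟩ := (hg t ht).2 hr
    refine ⟨l, hl.congr' ?_⟩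
    filter_upwards [self_mem_nhdsWithin] with s hs using (h' s hs.1).symm⟩

theorem ldContinuousOn_of_continuousOn (hg : ContinuousOn g S) : LdContinuousOn T S g :=
  fun t ht => ⟨fun _ => hg t ht, fun _ => ⟨g t, (hg t ht).mono inter_subset_left⟩⟩

theorem LdContinuousOn.add (hg : LdContinuousOn T S g) (hh : LdContinuousOn T S h) :
    LdContinuousOn T S (fun t => g t + h t) := fun t ht =>
  ⟨fun hr => ((hg t ht).1 hr).add ((hh t ht).1 hr), fun hr => by
    obtain ⟨l, hl⟩ := (hg t ht).2 hr
    obtain ⟨m, hm⟩ := (hh t ht).2 hr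
    exact ⟨l + m, hl.add hm⟩⟩

theorem LdContinuousOn.mul (hg : LdContinuousOn T S g) (hh : LdContinuousOn T S h) :
    LdContinuousOn T S (fun t => g t * h t) := fun t ht =>
  ⟨fun hr => ((hg t ht).1 hr).mul ((hh t ht).1 hr), fun hr => by
    obtain ⟨l, hl⟩ := (hg t ht).2 hr
    obtain ⟨m, hm⟩ := (hh t ht).2 hr
    exact ⟨l * m, hl.mul hm⟩⟩

theorem LdContinuousOn.const_mul (hg : LdContinuousOn T S g) (c : ℝ) :
    LdContinuousOn T S (fun t => c * g t) :=
  (ldContinuousOn_of_continuousOn continuousOn_const).mul hg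

theorem LdContinuousOn.sub (hg : LdContinuousOn T S g) (hh : LdContinuousOn T S h) :
    LdContinuousOn T S (fun t => g t - h t) :=
  (hg.add (hh.const_mul (-1))).congr fun t _ => by ring

namespace SpansInterval

/-- On each side of `t`, either `t` is scattered and there are no nearby points of `T`, or it is
dense and `g` has a one-sided limit. Compactness of `T` then makes the bound global in
`exists_bound`. -/
theorem eventually_bounded (hT : SpansInterval T a b) (hg : LdContinuousOn T (kappa T) g)
    (ht : t ∈ T) : ∃ C, ∀ᶠ s in 𝓝 t, s ∈ kappa T → |g s| ≤ C := by
  have hright : ∃ C, ∀ᶠ s in 𝓝 t, s ∈ kappa T ∩ Ioi t → |g s| ≤ C := by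
    rcases (le_sigma T t).lt_or_eq with h | h
    · refine ⟨0, ?_⟩
      filter_upwards [Iio_mem_nhds h] with s hs hs'
      exact absurd (sigma_le hs'.1.1 hs'.2) (not_le.2 hs)
    · have htk : t ∈ kappa T := ⟨ht, fun h' => h'.2.ne h⟩
      obtain ⟨l, hl⟩ := (hg t htk).2 h.symm
      refine ⟨|l| + 1, eventually_nhdsWithin_iff.1 ?_⟩
      exact (hl.abs.eventually_lt_const (lt_add_one _)).mono fun _ h => h.le
  have hleft : ∃ C, ∀ᶠ s in 𝓝 t, s ∈ kappa T ∩ Iio t → |g s| ≤ C := by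
    rcases (rho_le T t).lt_or_eq with h | h
    · refine ⟨0, ?_⟩
      filter_upwards [Ioi_mem_nhds h] with s hs hs'
      exact absurd (le_rho hs'.1.1 hs'.2) (not_le.2 hs)
    · by_cases htk : t ∈ kappa T
      · have hl := ((hg t htk).1 h).mono (inter_subset_left (t := Iio t))
        refine ⟨|g t| + 1, eventually_nhdsWithin_iff.1 ?_⟩
        exact (hl.abs.eventually_lt_const (lt_add_one _)).mono fun _ h => h.le
      · refine ⟨0, Eventually.of_forall fun s hs => ?_⟩
        exact absurd (hT.mem_kappa_of_lt ht ((hT.isLeast.2 hs.1.1).trans_lt hs.2)) htk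
  obtain ⟨C, hC⟩ := hright
  obtain ⟨D, hD⟩ := hleft
  refine ⟨max (max C D) |g t|, ?_⟩
  filter_upwards [hC, hD] with s h1 h2 hs
  rcases lt_trichotomy s t with h | h | h
  · exact (h2 ⟨hs, h⟩).trans ((le_max_right _ _).trans (le_max_left _ _))
  · rw [h]; exact le_max_right _ _
  · exact (h1 ⟨hs, h⟩).trans ((le_max_left _ _).trans (le_max_left _ _))

theorem exists_bound (hT : SpansInterval T a b) (hg : LdContinuousOn T (kappa T) g) :
    ∃ C, ∀ t ∈ kappa T, |g t| ≤ C := by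
  have : ∃ C, ∀ t ∈ T, t ∈ kappa T → |g t| ≤ C := by
    refine hT.isCompact.induction_on (p := fun U => ∃ C, ∀ t ∈ U, t ∈ kappa T → |g t| ≤ C)
      ⟨0, fun t ht => ht.elim⟩ ?_ ?_ ?_
    · rintro U V hUV ⟨C, hC⟩
      exact ⟨C, fun t ht => hC t (hUV ht)⟩
    · rintro U V ⟨C, hC⟩ ⟨D, hD⟩
      refine ⟨max C D, fun t ht htk => ?_⟩
      rcases ht with ht | ht
      · exact (hC t ht htk).trans (le_max_left _ _)
      · exact (hD t ht htk).trans (le_max_right _ _)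
    · intro t ht
      obtain ⟨C, hC⟩ := hT.eventually_bounded hg ht
      exact ⟨_, mem_nhdsWithin_of_mem_nhds hC, C, fun s hs => hs⟩
  obtain ⟨C, hC⟩ := this
  exact ⟨C, fun t ht => hC t ht.1 ht⟩

/-- Inside a gap, or at its right end, `ceilPt T` is constant just to the left of `s`. Otherwise `s`
itself is a left-dense point of `T`, where `g` is continuous. -/
theorem tendsto_comp_ceilPt (hT : SpansInterval T a b) (hg : LdContinuousOn T (kappa T) g)
    (hs : s ∈ Ioc a b) :
    Tendsto (fun u => g (ceilPt T u)) (𝓝[<] s) (𝓝 (g (ceilPt T s))) := by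
  have hmem := hT.ceilPt_mem hs.2
  have hle := hT.le_ceilPt hs.2
  rcases lt_or_ge (rho T (ceilPt T s)) s with h | h
  · refine tendsto_const_nhds.congr' ?_
    filter_upwards [Ioo_mem_nhdsLT h] with u hu
    rw [hT.ceilPt_eq_of_mem_Ioc hmem ⟨hu.1, hu.2.le.trans hle⟩]
  · have hr : rho T (ceilPt T s) = ceilPt T s :=
      le_antisymm (rho_le _ _) (ceilPt_le (rho_mem hT.isClosed hmem) h)
    have hst : ceilPt T s = s := by
      by_contra hne
      obtain ⟨u, hu, h1, h2⟩ := hT.exists_mem_Ioo_of_rho_eq (hs.1.trans_le hle) hr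
        (lt_of_le_of_ne hle (Ne.symm hne))
      exact absurd (ceilPt_le hu h1.le) (not_le.2 h2)
    have hc := (hg _ (hT.ceilPt_mem_kappa hs)).1 hr
    refine Tendsto.comp (y := 𝓝[kappa T] (ceilPt T s)) hc (tendsto_nhdsWithin_iff.2 ⟨?_, ?_⟩)
    · rw [hst]
      refine tendsto_of_tendsto_of_tendsto_of_le_of_le' (g := id) (h := fun _ => s)
        (tendsto_id.mono_left nhdsWithin_le_nhds) tendsto_const_nhds ?_ ?_
      · filter_upwards [self_mem_nhdsWithin] with u hu using hT.le_ceilPt ((le_of_lt hu).trans hs.2)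
      · filter_upwards [self_mem_nhdsWithin] with u hu
        exact ceilPt_le (hst ▸ hmem) (le_of_lt hu)
    · filter_upwards [Ioo_mem_nhdsLT hs.1] with u hu
      exact hT.ceilPt_mem_kappa ⟨hu.1, hu.2.le.trans hs.2⟩

end SpansInterval

theorem measurable_of_tendsto_nhdsLT {f : ℝ → ℝ} (hf : ∀ s, Tendsto f (𝓝[<] s) (𝓝 (f s))) :
    Measurable f := by
  -- The largest point below `s` of the grid of mesh `1 / (n + 1)`. Ceiling minus one, rather than
  -- floor, keeps it strictly less than `s`; `f ∘ p n` is measurable because it factors through `ℤ`.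
  let p : ℕ → ℝ → ℝ := fun n s => ((⌈((n : ℝ) + 1) * s⌉ : ℝ) - 1) / ((n : ℝ) + 1)
  refine measurable_of_tendsto_metrizable (f := fun n s => f (p n s)) (fun n => ?_) ?_
  · have h1 : Measurable fun k : ℤ => f (((k : ℝ) - 1) / ((n : ℝ) + 1)) := measurable_from_top
    exact h1.comp (Int.measurable_ceil.comp (measurable_const_mul _))
  · refine tendsto_pi_nhds.2 fun s => (hf s).comp (tendsto_nhdsWithin_iff.2 ⟨?_, ?_⟩)
    · refine tendsto_of_tendsto_of_tendsto_of_le_of_le (g := fun n : ℕ => s - 1 / ((n : ℝ) + 1))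
        (h := fun _ => s) ?_ tendsto_const_nhds ?_ ?_
      · simpa using tendsto_const_nhds.sub (tendsto_one_div_add_atTop_nhds_zero_nat (𝕜 := ℝ))
      · intro n
        have hn : (0 : ℝ) < (n : ℝ) + 1 := by positivity
        have := Int.le_ceil (((n : ℝ) + 1) * s)
        simp only [p]
        rw [le_div_iff₀ hn, sub_mul, one_div_mul_cancel hn.ne']
        linarith
      · intro n
        have hn : (0 : ℝ) < (n : ℝ) + 1 := by positivity
        have := Int.ceil_lt_add_one (((n : ℝ) + 1) * s)
        simp only [p]
        rw [div_le_iff₀ hn]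
        linarith
    · refine Eventually.of_forall fun n => ?_
      have hn : (0 : ℝ) < (n : ℝ) + 1 := by positivity
      have := Int.ceil_lt_add_one (((n : ℝ) + 1) * s)
      simp only [p, mem_Iio]
      rw [div_lt_iff₀ hn]
      linarith

namespace SpansInterval

open MeasureTheory

/-- Extended by zero outside `Ioc a b`, the function is left-continuous on all of `ℝ`, because the
interval is open on the left and closed on the right. -/
theorem aestronglyMeasurable_comp_ceilPt (hT : SpansInterval T a b)
    (hg : LdContinuousOn T (kappa T) g) :
    AEStronglyMeasurable (fun s => g (ceilPt T s)) (volume.restrict (Ioc a b)) := by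
  have : Measurable ((Ioc a b).indicator fun s => g (ceilPt T s)) := by
    refine measurable_of_tendsto_nhdsLT fun s => ?_
    by_cases hs : s ∈ Ioc a b
    · rw [indicator_of_mem hs]
      refine (hT.tendsto_comp_ceilPt hg hs).congr' ?_
      filter_upwards [Ioo_mem_nhdsLT hs.1] with u hu
      rw [indicator_of_mem (show u ∈ Ioc a b from ⟨hu.1, hu.2.le.trans hs.2⟩)]
    · rw [indicator_of_notMem hs]
      refine tendsto_const_nhds.congr' ?_
      rcases le_or_gt s a with h | h
      · filter_upwards [self_mem_nhdsWithin] with u hu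
        rw [indicator_of_notMem fun hu' => absurd (hu'.1.trans hu) (not_lt.2 h)]
      · have hbs : b < s := not_le.1 fun h' => hs ⟨h, h'⟩
        filter_upwards [Ioo_mem_nhdsLT hbs] with u hu
        rw [indicator_of_notMem fun hu' => absurd hu.1 (not_lt.2 hu'.2)]
  exact (aestronglyMeasurable_indicator_iff measurableSet_Ioc).1 this.aestronglyMeasurable

theorem intervalIntegrable_comp_ceilPt (hT : SpansInterval T a b)
    (hg : LdContinuousOn T (kappa T) g) {c d : ℝ} (hc : c ∈ Icc a b) (hd : d ∈ Icc a b) :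
    IntervalIntegrable (fun s => g (ceilPt T s)) volume c d := by
  obtain ⟨C, hC⟩ := hT.exists_bound hg
  have : IntervalIntegrable (fun s => g (ceilPt T s)) volume a b := by
    rw [intervalIntegrable_iff_integrableOn_Ioc_of_le hT.lt.le]
    refine IntegrableOn.of_bound (by simp) (hT.aestronglyMeasurable_comp_ceilPt hg) C ?_
    refine (ae_restrict_iff' measurableSet_Ioc).2 (Eventually.of_forall fun s hs => ?_)
    exact hC _ (hT.ceilPt_mem_kappa hs)
  refine this.mono_set ?_
  rw [uIcc_of_le hT.lt.le]
  exact uIcc_subset_Icc hc hd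

theorem nablaIntegral_congr (hT : SpansInterval T a b) (hgh : ∀ t ∈ kappa T, g t = h t) :
    nablaIntegral T g a b = nablaIntegral T h a b := by
  refine intervalIntegral.integral_congr_ae (Eventually.of_forall fun s hs => ?_)
  rw [uIoc_of_le hT.lt.le] at hs
  exact hgh _ (hT.ceilPt_mem_kappa hs)

end SpansInterval

end

/-! ### Nabla derivatives and the fundamental theorem of calculus. -/

section

variable {T S : Set ℝ} {a b s t c d d' : ℝ} {f g h : ℝ → ℝ}

/-- As `s` tends to `t`, `ρ(t) - s` stays away from `0`. Hence the defining estimate just says that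
the error vanishes at `s = t` (the slope equation) and tends to `0` there (continuity). -/
theorem hasNablaDerivAt_iff_of_rho_lt (ht : t ∈ T) (hr : rho T t < t) :
    HasNablaDerivAt T f d t ↔
      ContinuousWithinAt f T t ∧ f t - f (rho T t) = d * (t - rho T t) := by
  constructor
  · intro H
    have hp : 0 < |rho T t - t| := abs_pos.2 (sub_ne_zero.2 hr.ne)
    have hself : f t - f (rho T t) = d * (t - rho T t) := by
      have h0 : |f (rho T t) - f t - d * (rho T t - t)| ≤ 0 := by
        refine le_of_forall_pos_le_add fun e he => ?_
        have := (H (e / |rho T t - t|) (div_pos he hp)).self_of_nhdsWithin ht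
        rwa [div_mul_cancel₀ _ hp.ne', ← zero_add e] at this
      have := abs_nonpos_iff.1 h0
      linarith
    refine ⟨?_, hself⟩
    have hu : Tendsto (fun s => f (rho T t) - f s - d * (rho T t - s)) (𝓝[T] t) (𝓝 0) := by
      refine Metric.tendsto_nhds.2 fun e he => ?_
      have hM : 0 < |rho T t - t| + 1 := by positivity
      have hc : Tendsto (fun s => |rho T t - s|) (𝓝[T] t) (𝓝 |rho T t - t|) :=
        ((continuous_const.sub continuous_id).abs.tendsto t).mono_left nhdsWithin_le_nhds
      filter_upwards [H (e / 2 / (|rho T t - t| + 1)) (by positivity),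
        hc.eventually_lt_const (lt_add_one _)] with s h1 h2
      rw [Real.dist_eq, sub_zero]
      refine h1.trans_lt ?_
      calc e / 2 / (|rho T t - t| + 1) * |rho T t - s|
          ≤ e / 2 / (|rho T t - t| + 1) * (|rho T t - t| + 1) := by gcongr
        _ = e / 2 := div_mul_cancel₀ _ hM.ne'
        _ < e := half_lt_self he
    have hl : Tendsto (fun s => f (rho T t) - d * (rho T t - s)) (𝓝[T] t)
        (𝓝 (f (rho T t) - d * (rho T t - t))) :=
      (Continuous.tendsto (by fun_prop) t).mono_left nhdsWithin_le_nhds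
    have := hl.sub hu
    have e1 : f (rho T t) - d * (rho T t - t) - 0 = f t := by linarith
    rw [e1] at this
    exact this.congr fun s => by ring
  · rintro ⟨hc, he⟩ ε hε
    have hp : 0 < |rho T t - t| := abs_pos.2 (sub_ne_zero.2 hr.ne)
    have hid : Tendsto (fun s : ℝ => rho T t - s) (𝓝[T] t) (𝓝 (rho T t - t)) :=
      (Continuous.tendsto (by fun_prop) t).mono_left nhdsWithin_le_nhds
    have h1 : Tendsto (fun s => |f (rho T t) - f s - d * (rho T t - s)|) (𝓝[T] t)
        (𝓝 |f (rho T t) - f t - d * (rho T t - t)|) :=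
      ((tendsto_const_nhds.sub hc).sub (hid.const_mul d)).abs
    have h2 : Tendsto (fun s => ε * |rho T t - s|) (𝓝[T] t) (𝓝 (ε * |rho T t - t|)) :=
      hid.abs.const_mul ε
    have h3 : f (rho T t) - f t - d * (rho T t - t) = 0 := by linarith
    rw [h3, abs_zero] at h1
    exact (h1.eventually_lt h2 (mul_pos hε hp)).mono fun _ h => h.le

theorem hasNablaDerivAt_iff_of_rho_eq (hr : rho T t = t) :
    HasNablaDerivAt T f d t ↔ HasDerivWithinAt f d T t := by
  rw [hasDerivWithinAt_iff_isLittleO, Asymptotics.isLittleO_iff]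
  refine forall_congr' fun ε => imp_congr Iff.rfl ?_
  refine eventually_congr (Eventually.of_forall fun s => ?_)
  rw [hr, Real.norm_eq_abs, Real.norm_eq_abs, abs_sub_comm t s, ← abs_neg, smul_eq_mul,
    show -(f t - f s - d * (t - s)) = f s - f t - (s - t) * d by ring]

theorem HasNablaDerivAt.continuousWithinAt (hf : HasNablaDerivAt T f d t) (ht : t ∈ T) :
    ContinuousWithinAt f T t := by
  rcases (rho_le T t).lt_or_eq with hr | hr
  · exact ((hasNablaDerivAt_iff_of_rho_lt ht hr).1 hf).1
  · exact ((hasNablaDerivAt_iff_of_rho_eq hr).1 hf).continuousWithinAt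

theorem HasNablaDerivAt.mul (hf : HasNablaDerivAt T f d t) (hg : HasNablaDerivAt T g d' t)
    (ht : t ∈ T) :
    HasNablaDerivAt T (fun s => f s * g s) (d * g (rho T t) + f t * d') t := by
  rcases (rho_le T t).lt_or_eq with hr | hr
  · rw [hasNablaDerivAt_iff_of_rho_lt ht hr] at *
    exact ⟨hf.1.mul hg.1, by linear_combination g (rho T t) * hf.2 + f t * hg.2⟩
  · rw [hasNablaDerivAt_iff_of_rho_eq hr] at *
    rw [hr]
    exact hf.mul hg

theorem HasNablaDerivAt.add (hf : HasNablaDerivAt T f d t) (hg : HasNablaDerivAt T g d' t)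
    (ht : t ∈ T) : HasNablaDerivAt T (fun s => f s + g s) (d + d') t := by
  rcases (rho_le T t).lt_or_eq with hr | hr
  · rw [hasNablaDerivAt_iff_of_rho_lt ht hr] at *
    exact ⟨hf.1.add hg.1, by linear_combination hf.2 + hg.2⟩
  · rw [hasNablaDerivAt_iff_of_rho_eq hr] at *
    exact hf.add hg

theorem hasNablaDerivAt_linear (ht : t ∈ T) (c d : ℝ) :
    HasNablaDerivAt T (fun s => c + d * s) d t := by
  rcases (rho_le T t).lt_or_eq with hr | hr
  · rw [hasNablaDerivAt_iff_of_rho_lt ht hr]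
    exact ⟨(by fun_prop : Continuous fun s => c + d * s).continuousWithinAt, by ring⟩
  · rw [hasNablaDerivAt_iff_of_rho_eq hr]
    simpa using (((hasDerivAt_id t).const_mul d).const_add c).hasDerivWithinAt (s := T)

theorem HasNablaDerivAt.const_mul (hf : HasNablaDerivAt T f d t) (ht : t ∈ T) (c : ℝ) :
    HasNablaDerivAt T (fun s => c * f s) (c * d) t := by
  have := (hasNablaDerivAt_linear ht c 0).mul hf ht
  simpa using this

namespace SpansInterval

/-- Points of `T` accumulate from the left if `a < t`. At `t = a`, where `ρ(a) = a` by convention,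
membership in `T_κ` makes `a` right-dense. This is what makes nabla derivatives unique on `T_κ`. -/
theorem accPt_of_rho_eq (hT : SpansInterval T a b) (ht : t ∈ kappa T) (hr : rho T t = t) :
    AccPt t (𝓟 T) := by
  refine accPt_iff_frequently.2 (frequently_iff.2 fun {U} hU => ?_)
  obtain ⟨l, u, htm, hlu⟩ := mem_nhds_iff_exists_Ioo_subset.1 hU
  rcases (hT.mem_kappa_iff.1 ht).2 with h | ⟨rfl, h⟩
  · obtain ⟨s, hs, h1, h2⟩ := hT.exists_mem_Ioo_of_rho_eq h hr htm.1
    exact ⟨s, hlu ⟨h1, h2.trans htm.2⟩, h2.ne, hs⟩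
  · obtain ⟨s, hs, h1, h2⟩ := hT.exists_mem_Ioo_of_sigma_eq hT.lt h htm.2
    exact ⟨s, hlu ⟨htm.1.trans h1, h2⟩, h1.ne', hs⟩

theorem hasNablaDerivAt_unique (hT : SpansInterval T a b) (ht : t ∈ kappa T)
    (h : HasNablaDerivAt T f d t) (h' : HasNablaDerivAt T f d' t) : d = d' := by
  rcases (rho_le T t).lt_or_eq with hr | hr
  · rw [hasNablaDerivAt_iff_of_rho_lt ht.1 hr] at h h'
    exact mul_right_cancel₀ (sub_ne_zero.2 hr.ne') (h.2.symm.trans h'.2)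
  · rw [hasNablaDerivAt_iff_of_rho_eq hr] at h h'
    exact (hT.accPt_of_rho_eq ht hr).uniqueDiffWithinAt.eq_deriv T h h'

theorem nablaDeriv_eq (hT : SpansInterval T a b) (ht : t ∈ kappa T)
    (h : HasNablaDerivAt T f d t) : nablaDeriv T f t = d := by
  have hex : ∃ d, HasNablaDerivAt T f d t := ⟨d, h⟩
  rw [nablaDeriv, dif_pos hex]
  exact hT.hasNablaDerivAt_unique ht hex.choose_spec h

theorem hasNablaDerivAt_nablaDeriv (hf : IsC1ld T f) (ht : t ∈ kappa T) :
    HasNablaDerivAt T f (nablaDeriv T f t) t := by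
  rw [nablaDeriv, dif_pos (hf.1 t ht)]
  exact (hf.1 t ht).choose_spec

theorem isC1ld_of_hasNablaDerivAt (hT : SpansInterval T a b)
    (h : ∀ t ∈ kappa T, HasNablaDerivAt T f (g t) t) (hg : LdContinuousOn T (kappa T) g) :
    IsC1ld T f :=
  ⟨fun t ht => ⟨_, h t ht⟩, hg.congr fun t ht => hT.nablaDeriv_eq ht (h t ht)⟩

theorem continuousOn_of_hasNablaDerivAt (hT : SpansInterval T a b)
    (h : ∀ t ∈ kappa T, HasNablaDerivAt T f (g t) t) : ContinuousOn f T := by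
  intro t ht
  by_cases htk : t ∈ kappa T
  · exact (h t htk).continuousWithinAt ht
  -- A point outside `T_κ` is a right-scattered minimum, hence isolated in `T`.
  · have hlt : t < sigma T t := by
      by_contra h'
      exact htk ⟨ht, fun h'' => h' h''.2⟩
    have hta : t = a := by
      by_contra h'
      exact htk (hT.mem_kappa_of_lt ht (lt_of_le_of_ne (hT.isLeast.2 ht) (Ne.symm h')))
    refine tendsto_const_nhds.congr' ?_
    filter_upwards [mem_nhdsWithin_of_mem_nhds (Iio_mem_nhds hlt), self_mem_nhdsWithin] with s h1 h2
    congr 1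
    refine le_antisymm (hta ▸ hT.isLeast.2 h2) (not_lt.1 fun h3 => ?_)
    exact absurd (sigma_le h2 h3) (not_le.2 h1)

theorem continuousOn_of_isC1ld (hT : SpansInterval T a b) (hf : IsC1ld T f) : ContinuousOn f T :=
  hT.continuousOn_of_hasNablaDerivAt fun _ ht => hasNablaDerivAt_nablaDeriv hf ht

/-- At a right-dense `t` the limit from the right is `f t`, which may differ from `f (ρ(t))`: points
`s > t` of `T` have `t ≤ ρ(s) ≤ s`. -/
theorem ldContinuousOn_comp_rho (hT : SpansInterval T a b) (hf : ContinuousOn f T) :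
    LdContinuousOn T (kappa T) (fun t => f (rho T t)) := by
  refine fun t ht => ⟨fun hr => ?_, fun _ => ⟨f t, ?_⟩⟩
  · change Tendsto (fun s => f (rho T s)) _ (𝓝 (f (rho T t)))
    rw [hr]
    refine (hf t ht.1).tendsto.comp (tendsto_nhdsWithin_iff.2 ⟨tendsto_order.2 ⟨?_, ?_⟩, ?_⟩)
    · intro l hl
      rcases (hT.isLeast.2 ht.1).lt_or_eq with h | h
      · obtain ⟨u, hu, h1, h2⟩ := hT.exists_mem_Ioo_of_rho_eq h hr hl
        filter_upwards [mem_nhdsWithin_of_mem_nhds (Ioi_mem_nhds h2)] with s hs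
        exact h1.trans_le (le_rho hu hs)
      · filter_upwards [self_mem_nhdsWithin] with s hs
        exact (h ▸ hl).trans_le (hT.isLeast.2 (rho_mem hT.isClosed hs.1))
    · intro u hu
      filter_upwards [mem_nhdsWithin_of_mem_nhds (Iio_mem_nhds hu)] with s hs
      exact (rho_le T s).trans_lt hs
    · filter_upwards [self_mem_nhdsWithin] with s hs using rho_mem hT.isClosed hs.1
  · refine (hf t ht.1).tendsto.comp (tendsto_nhdsWithin_iff.2 ⟨tendsto_order.2 ⟨?_, ?_⟩, ?_⟩)
    · intro l hl
      filter_upwards [self_mem_nhdsWithin] with s hs using hl.trans_le (le_rho ht.1 hs.2)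
    · intro u hu
      filter_upwards [mem_nhdsWithin_of_mem_nhds (Iio_mem_nhds hu)] with s hs
      exact (rho_le T s).trans_lt hs
    · filter_upwards [self_mem_nhdsWithin] with s hs using rho_mem hT.isClosed hs.1.1

/-- A mean value inequality with slope `ε`, proved by looking at the infimum `m` of the points
violating it. The bound passes to `m` from the left, and the derivative estimate at `m` carries it
past `m`; then `ε` is arbitrary. -/
theorem eq_of_hasNablaDerivAt_zero (hT : SpansInterval T a b)
    (hf : ∀ t ∈ kappa T, HasNablaDerivAt T f 0 t) (ht : t ∈ T) : f t = f a := by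
  suffices H : ∀ ε > 0, ∀ t ∈ T, |f t - f a| ≤ ε * (t - a) by
    have hba := sub_pos.2 hT.lt
    have : |f t - f a| ≤ 0 := by
      refine le_of_forall_pos_le_add fun e he => ?_
      have h1 := H (e / (b - a)) (div_pos he hba) t ht
      have h2 : e / (b - a) * (t - a) ≤ e / (b - a) * (b - a) :=
        mul_le_mul_of_nonneg_left (sub_le_sub_right (hT.isGreatest.2 ht) a) (div_pos he hba).le
      rw [div_mul_cancel₀ _ hba.ne'] at h2
      linarith
    exact sub_eq_zero.1 (abs_nonpos_iff.1 this)
  intro ε hε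
  by_contra! hbad
  set B := {w | w ∈ T ∧ ε * (w - a) < |f w - f a|} with hB
  have hne : B.Nonempty := hbad
  have hbdd : BddBelow B := ⟨a, fun w hw => hT.isLeast.2 hw.1⟩
  set m := sInf B with hm
  have hmcl : m ∈ closure B := csInf_mem_closure hne hbdd
  have hmT : m ∈ T := hT.isClosed.closure_subset_iff.2 (fun w hw => hw.1) hmcl
  have hgood : ∀ w ∈ T, w < m → |f w - f a| ≤ ε * (w - a) := fun w hw hwm =>
    not_lt.1 fun h' => notMem_of_lt_csInf hwm hbdd ⟨hw, h'⟩
  have hnear : m ∈ kappa T → ∀ᶠ s in 𝓝[T] m, |f (rho T m) - f s| ≤ ε * |rho T m - s| := by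
    intro hk
    filter_upwards [hf m hk ε hε] with s hs
    simpa using hs
  have hmgood : |f m - f a| ≤ ε * (m - a) := by
    rcases (hT.isLeast.2 hmT).lt_or_eq with h | h
    · have hev := hnear (hT.mem_kappa_of_lt hmT h)
      rcases (rho_le T m).lt_or_eq with hr | hr
      · have h1 := hev.self_of_nhdsWithin hmT
        have h2 := hgood _ (rho_mem hT.isClosed hmT) hr
        rw [abs_sub_comm (rho T m), abs_of_pos (sub_pos.2 hr), abs_sub_comm] at h1
        have h3 := abs_sub_le (f m) (f (rho T m)) (f a)
        linarith
      · rw [hr, eventually_nhdsWithin_iff] at hev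
        obtain ⟨l, u, hlu, hsub⟩ := mem_nhds_iff_exists_Ioo_subset.1 hev
        obtain ⟨s, hs, h1, h2⟩ := hT.exists_mem_Ioo_of_rho_eq h hr hlu.1
        have h3 := hsub ⟨h1, h2.trans hlu.2⟩ hs
        rw [abs_of_pos (sub_pos.2 h2)] at h3
        have h4 := hgood s hs h2
        have h5 := abs_sub_le (f m) (f s) (f a)
        linarith
    · rw [← h]; simp
  have hmB : m ∉ B := fun h => absurd h.2 (not_lt.2 hmgood)
  have hmk : m ∈ kappa T := by
    refine ⟨hmT, fun h => ?_⟩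
    obtain ⟨w, hw, hwm⟩ := exists_lt_of_csInf_lt hne h.2
    have hle : m ≤ w := csInf_le hbdd hw
    rcases hle.lt_or_eq with h' | h'
    · exact absurd (sigma_le hw.1 h') (not_le.2 hwm)
    · exact hmB (h' ▸ hw)
  -- A violating `w` near `m` is compared with `ρ(m)`, where the inequality holds: the increment
  -- from `ρ(m)` to `w` is at most `ε (w - ρ(m))`, a contradiction.
  obtain ⟨w, hw, hwB⟩ := ((mem_closure_iff_frequently.1 hmcl).and_eventually
    (eventually_nhdsWithin_iff.1 (hnear hmk))).exists
  have hle : m ≤ w := csInf_le hbdd hw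
  have h1 := hwB hw.1
  have hrg : |f (rho T m) - f a| ≤ ε * (rho T m - a) := by
    rcases (rho_le T m).lt_or_eq with hr | hr
    · exact hgood _ (rho_mem hT.isClosed hmT) hr
    · rw [hr]; exact hmgood
  rw [abs_sub_comm (rho T m), abs_of_nonneg (sub_nonneg.2 ((rho_le T m).trans hle)),
    abs_sub_comm] at h1
  have h2 := abs_sub_le (f w) (f (rho T m)) (f a)
  linarith [hw.2]

/-- At a left-scattered `t` the integrand is the constant `g t` on `(ρ(t), t]`. At a left-dense `t`
continuity of `g` makes it uniformly close to `g t`. -/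
theorem hasNablaDerivAt_nablaIntegral (hT : SpansInterval T a b)
    (hg : LdContinuousOn T (kappa T) g) (ht : t ∈ kappa T) :
    HasNablaDerivAt T (nablaIntegral T g a) (g t) t := by
  have hIcc : ∀ s ∈ T, s ∈ Icc a b := fun s hs => ⟨hT.isLeast.2 hs, hT.isGreatest.2 hs⟩
  have hint : ∀ s ∈ T, ∀ u ∈ T,
      IntervalIntegrable (fun w => g (ceilPt T w)) MeasureTheory.volume s u :=
    fun s hs u hu => hT.intervalIntegrable_comp_ceilPt hg (hIcc s hs) (hIcc u hu)
  have haT := hT.isLeast.1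
  have hsub : ∀ s ∈ T, ∀ u ∈ T, nablaIntegral T g a u - nablaIntegral T g a s
      = ∫ w in s..u, g (ceilPt T w) := fun s hs u hu =>
    intervalIntegral.integral_interval_sub_left (hint a haT u hu) (hint a haT s hs)
  rcases (rho_le T t).lt_or_eq with hr | hr
  · rw [hasNablaDerivAt_iff_of_rho_lt ht.1 hr]
    constructor
    · have hc := intervalIntegral.continuousOn_primitive_interval'
        (hint a haT b hT.isGreatest.1) left_mem_uIcc
      rw [uIcc_of_le hT.lt.le] at hc
      exact (hc.mono hIcc) t ht.1
    · rw [hsub _ (rho_mem hT.isClosed ht.1) _ ht.1]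
      rw [intervalIntegral.integral_congr_ae (g := fun _ => g t)]
      · simp [mul_comm]
      · refine Eventually.of_forall fun s hs => ?_
        rw [uIoc_of_le hr.le] at hs
        rw [hT.ceilPt_eq_of_mem_Ioc ht.1 hs]
  · intro ε hε
    have hc := Metric.tendsto_nhds.1 ((hg t ht).1 hr).tendsto ε hε
    rw [eventually_nhdsWithin_iff] at hc
    obtain ⟨δ, hδ, hball⟩ := Metric.eventually_nhds_iff.1 hc
    filter_upwards [self_mem_nhdsWithin, mem_nhdsWithin_of_mem_nhds (Metric.ball_mem_nhds t hδ)]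
      with s hs hsδ
    rw [hr, hsub s hs t ht.1]
    have e1 : (∫ w in s..t, g (ceilPt T w)) - g t * (t - s)
        = ∫ w in s..t, (g (ceilPt T w) - g t) := by
      rw [intervalIntegral.integral_sub (hint s hs t ht.1) intervalIntegrable_const]
      simp [mul_comm]
    rw [e1, ← Real.norm_eq_abs]
    refine intervalIntegral.norm_integral_le_of_norm_le_const fun w hw => ?_
    rw [uIoc, mem_Ioc] at hw
    have hw1 : a < w := (le_min (hIcc s hs).1 (hIcc t ht.1).1).trans_lt hw.1
    have hw2 : w ≤ b := hw.2.trans (max_le (hIcc s hs).2 (hIcc t ht.1).2)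
    refine (hball ?_ (hT.ceilPt_mem_kappa ⟨hw1, hw2⟩)).le
    have hlow := hw.1.trans_le (hT.le_ceilPt hw2)
    -- Both ends lie in `T`, so `ceilPt T` cannot leave the interval between `s` and `t`.
    have hup : ceilPt T w ≤ max s t := by
      rcases le_total s t with h | h
      · rw [max_eq_right h] at *; exact ceilPt_le ht.1 hw.2
      · rw [max_eq_left h] at *; exact ceilPt_le hs hw.2
    have hsδ' : |s - t| < δ := hsδ
    rw [Real.dist_eq]
    rw [abs_lt] at hsδ' ⊢
    rcases le_total s t with h | h
    · rw [max_eq_right h] at hup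
      rw [min_eq_left h] at hlow
      constructor <;> linarith
    · rw [max_eq_left h] at hup
      rw [min_eq_right h] at hlow
      constructor <;> linarith

theorem nablaIntegral_eq_sub (hT : SpansInterval T a b)
    (hf : ∀ t ∈ kappa T, HasNablaDerivAt T f (g t) t) (hg : LdContinuousOn T (kappa T) g) :
    nablaIntegral T g a b = f b - f a := by
  have h0 : ∀ t ∈ kappa T, HasNablaDerivAt T (fun s => nablaIntegral T g a s + (-1) * f s) 0 t := by
    intro t ht
    have := (hT.hasNablaDerivAt_nablaIntegral hg ht).add ((hf t ht).const_mul ht.1 (-1)) ht.1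
    simpa using this
  have := hT.eq_of_hasNablaDerivAt_zero h0 hT.isGreatest.1
  have ha : nablaIntegral T g a a = 0 := intervalIntegral.integral_same
  rw [ha] at this
  linarith

end SpansInterval

end

/-! ### First variation of a functional and the Dubois-Reymond lemma. -/

section

variable {T : Set ℝ} {a b t : ℝ} {f : ℝ → ℝ → ℝ → ℝ} {x η e g h φ : ℝ → ℝ}

/-- Joint continuity of the two partial derivatives yields total differentiability in `(y, v)`; then
the chain rule applies. -/
theorem IsLagrangian.hasDerivAt_line (hf : IsLagrangian T f) (ht : t ∈ kappa T) (p q u w ε : ℝ) :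
    HasDerivAt (fun ε => f t (p + ε * q) (u + ε * w))
      (partialY f t (p + ε * q) (u + ε * w) * q + partialV f t (p + ε * q) (u + ε * w) * w) ε := by
  have h1 := (hasStrictFDerivAt_uncurry_coprod (𝕜 := ℝ) (u := (p + ε * q, u + ε * w))
    (f := fun y v => f t y v)
    (f₁ := fun y v => ContinuousLinearMap.toSpanSingleton ℝ (partialY f t y v))
    (f₂ := fun y v => ContinuousLinearMap.toSpanSingleton ℝ (partialV f t y v))
    (Eventually.of_forall fun v => (hf.differentiable_y t ht v.2 v.1).hasDerivAt.hasFDerivAt)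
    (Eventually.of_forall fun v => (hf.differentiable_v t ht v.1 v.2).hasDerivAt.hasFDerivAt)
    (((ContinuousLinearMap.toSpanSingletonCLE (𝕜 := ℝ) (E := ℝ)).continuous.comp
      (hf.continuous_y t ht)).continuousAt)
    (((ContinuousLinearMap.toSpanSingletonCLE (𝕜 := ℝ) (E := ℝ)).continuous.comp
      (hf.continuous_v t ht)).continuousAt)).hasFDerivAt
  have h2 : HasDerivAt (fun ε : ℝ => (p + ε * q, u + ε * w)) (q, w) ε := by
    refine HasDerivAt.prodMk ?_ ?_
    · simpa using ((hasDerivAt_id ε).mul_const q).const_add p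
    · simpa using ((hasDerivAt_id ε).mul_const w).const_add u
  have h3 := h1.comp_hasDerivAt ε h2
  exact h3.congr_deriv (by
    simp [ContinuousLinearMap.coprod_apply, ContinuousLinearMap.toSpanSingleton_apply, mul_comm,
      Function.HasUncurry.uncurry])

theorem hasNablaDerivAt_add_mul (hx : IsC1ld T x) (hη : ∀ t ∈ kappa T, HasNablaDerivAt T η (e t) t)
    (ε : ℝ) (ht : t ∈ kappa T) :
    HasNablaDerivAt T (fun t => x t + ε * η t) (nablaDeriv T x t + ε * e t) t :=
  (SpansInterval.hasNablaDerivAt_nablaDeriv hx ht).add ((hη t ht).const_mul ht.1 ε) ht.1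

namespace SpansInterval

theorem isC1ld_add_mul (hT : SpansInterval T a b) (hx : IsC1ld T x)
    (hη : ∀ t ∈ kappa T, HasNablaDerivAt T η (e t) t) (he : LdContinuousOn T (kappa T) e) (ε : ℝ) :
    IsC1ld T (fun t => x t + ε * η t) :=
  hT.isC1ld_of_hasNablaDerivAt (fun _ ht => hasNablaDerivAt_add_mul hx hη ε ht)
    (hx.2.add (he.const_mul ε))

/-- The first variation of a nabla functional. -/
theorem hasDerivAt_functional (hT : SpansInterval T a b) (hf : IsLagrangian T f) (hx : IsC1ld T x)
    (hη : ∀ t ∈ kappa T, HasNablaDerivAt T η (e t) t) (he : LdContinuousOn T (kappa T) e) :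
    HasDerivAt (fun ε => functional T a b f (fun t => x t + ε * η t))
      (nablaIntegral T (fun t => along T (partialY f) x t * η (rho T t)
        + along T (partialV f) x t * e t) a b) 0 := by
  have hηρ := hT.ldContinuousOn_comp_rho (hT.continuousOn_of_hasNablaDerivAt hη)
  have hxρ := hT.ldContinuousOn_comp_rho (hT.continuousOn_of_isC1ld hx)
  obtain ⟨X, hX⟩ := hT.exists_bound hxρ
  obtain ⟨X', hX'⟩ := hT.exists_bound hx.2
  obtain ⟨N, hN⟩ := hT.exists_bound hηρ
  obtain ⟨E, hE⟩ := hT.exists_bound he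
  -- For `|ε| ≤ 1` both arguments of the perturbed integrand stay within this radius, so `C * N + C
  -- * E` dominates the `ε`-derivative.
  obtain ⟨C, hC⟩ := hf.bounded (max (X + N) (X' + E))
  have halong : ∀ ε, ∀ t ∈ kappa T, along T f (fun t => x t + ε * η t) t
      = f t (x (rho T t) + ε * η (rho T t)) (nablaDeriv T x t + ε * e t) := fun ε t ht => by
    rw [along, hT.nablaDeriv_eq ht (hasNablaDerivAt_add_mul hx hη ε ht)]
  have hld : ∀ ε, LdContinuousOn T (kappa T)
      (fun t => f t (x (rho T t) + ε * η (rho T t)) (nablaDeriv T x t + ε * e t)) := fun ε =>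
    (hf.ldContinuous _ (hT.isC1ld_add_mul hx hη he ε)).congr fun t ht => (halong ε t ht).symm
  have hfun : (fun ε => functional T a b f (fun t => x t + ε * η t)) = fun ε =>
      ∫ s in a..b, (fun t => f t (x (rho T t) + ε * η (rho T t)) (nablaDeriv T x t + ε * e t))
        (ceilPt T s) :=
    funext fun ε => hT.nablaIntegral_congr (halong ε)
  have haI : a ∈ Icc a b := left_mem_Icc.2 hT.lt.le
  have hbI : b ∈ Icc a b := right_mem_Icc.2 hT.lt.le
  rw [hfun]
  let F' : ℝ → ℝ → ℝ := fun ε s =>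
    (fun t => partialY f t (x (rho T t) + ε * η (rho T t)) (nablaDeriv T x t + ε * e t)
        * η (rho T t)
      + partialV f t (x (rho T t) + ε * η (rho T t)) (nablaDeriv T x t + ε * e t) * e t)
      (ceilPt T s)
  have hF'0 : F' 0 = fun s => (fun t => along T (partialY f) x t * η (rho T t)
        + along T (partialV f) x t * e t) (ceilPt T s) := by
    funext s
    simp only [F', zero_mul, add_zero, along]
  have hF'ld : LdContinuousOn T (kappa T) (fun t => along T (partialY f) x t * η (rho T t)
        + along T (partialV f) x t * e t) :=
    ((hf.ldContinuous_y x hx).mul hηρ).add ((hf.ldContinuous_v x hx).mul he)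
  have key := (intervalIntegral.hasDerivAt_integral_of_dominated_loc_of_deriv_le
    (μ := MeasureTheory.volume) (a := a) (b := b) (x₀ := (0 : ℝ)) (s := Metric.ball 0 1)
    (F := fun ε s => (fun t => f t (x (rho T t) + ε * η (rho T t)) (nablaDeriv T x t + ε * e t))
        (ceilPt T s)) (F' := F') (bound := fun _ => C * N + C * E)
    (Metric.ball_mem_nhds 0 one_pos)
    (Eventually.of_forall fun ε => by
      rw [uIoc_of_le hT.lt.le]
      exact hT.aestronglyMeasurable_comp_ceilPt (hld ε))
    (hT.intervalIntegrable_comp_ceilPt (hld 0) haI hbI)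
    (by
      rw [hF'0, uIoc_of_le hT.lt.le]
      exact hT.aestronglyMeasurable_comp_ceilPt hF'ld)
    (Eventually.of_forall fun s hs ε hε => by
      rw [uIoc_of_le hT.lt.le] at hs
      have ht := hT.ceilPt_mem_kappa hs
      have hε1 : |ε| ≤ 1 := by simpa using (mem_ball_zero_iff.1 hε).le
      have hb : ∀ p q P R : ℝ, |p| ≤ P → |q| ≤ R → |p + ε * q| ≤ P + R := by
        intro p q P R hp hq
        refine (abs_add_le _ _).trans (add_le_add hp ?_)
        rw [abs_mul]
        exact (mul_le_of_le_one_left (abs_nonneg _) hε1).trans hq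
      obtain ⟨h1, h2⟩ := hC _ ht _ _
        ((hb _ _ _ _ (hX _ ht) (hN _ ht)).trans (le_max_left _ _))
        ((hb _ _ _ _ (hX' _ ht) (hE _ ht)).trans (le_max_right _ _))
      have hC0 : 0 ≤ C := (abs_nonneg _).trans h1
      refine (norm_add_le _ _).trans (add_le_add ?_ ?_)
      · rw [norm_mul]
        exact mul_le_mul h1 (hN _ ht) (abs_nonneg _) hC0
      · rw [norm_mul]
        exact mul_le_mul h2 (hE _ ht) (abs_nonneg _) hC0)
    intervalIntegrable_const
    (Eventually.of_forall fun s hs ε _ => by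
      rw [uIoc_of_le hT.lt.le] at hs
      exact hf.hasDerivAt_line (hT.ceilPt_mem_kappa hs) _ _ _ _ _)).2
  rw [hF'0] at key
  exact key

/-- The primitive of `g²` is squeezed to `0` on all of `T`. Uniqueness of its nabla derivative then
gives `g² = 0` at every point of `T_κ`, not just almost everywhere. -/
theorem eq_zero_of_nablaIntegral_sq (hT : SpansInterval T a b) (hg : LdContinuousOn T (kappa T) g)
    (h0 : nablaIntegral T (fun t => g t * g t) a b = 0) (ht : t ∈ kappa T) : g t = 0 := by
  have hg2 := hg.mul hg
  have hnonneg : ∀ {c d : ℝ}, c ≤ d → 0 ≤ nablaIntegral T (fun t => g t * g t) c d :=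
    fun hcd => intervalIntegral.integral_nonneg_of_forall hcd fun _ => mul_self_nonneg _
  have hA : ∀ s ∈ T, nablaIntegral T (fun t => g t * g t) a s = 0 := by
    intro s hs
    have has := hT.isLeast.2 hs
    have hsb := hT.isGreatest.2 hs
    have h1 := hnonneg has
    have h2 := hnonneg hsb
    have h3 : nablaIntegral T (fun t => g t * g t) a s + nablaIntegral T (fun t => g t * g t) s b
        = nablaIntegral T (fun t => g t * g t) a b :=
      intervalIntegral.integral_add_adjacent_intervals
        (hT.intervalIntegrable_comp_ceilPt hg2 (left_mem_Icc.2 hT.lt.le) ⟨has, hsb⟩)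
        (hT.intervalIntegrable_comp_ceilPt hg2 ⟨has, hsb⟩ (right_mem_Icc.2 hT.lt.le))
    linarith
  have h0' : HasNablaDerivAt T (nablaIntegral T (fun t => g t * g t) a) 0 t := by
    intro ε hε
    filter_upwards [self_mem_nhdsWithin] with s hs
    rw [hA _ (rho_mem hT.isClosed ht.1), hA s hs]
    simpa using by positivity
  exact mul_self_eq_zero.1
    (hT.hasNablaDerivAt_unique ht (hT.hasNablaDerivAt_nablaIntegral hg2 ht) h0')

/-- The lemma of Dubois-Reymond; `Pa` and `Pb` say that the end points are fixed. -/
theorem dubois_reymond (hT : SpansInterval T a b) (hh : LdContinuousOn T (kappa T) h)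
    (hφ : LdContinuousOn T (kappa T) φ) {Pa Pb : Prop}
    (hvar : ∀ η e : ℝ → ℝ, (∀ t ∈ kappa T, HasNablaDerivAt T η (e t) t) →
      LdContinuousOn T (kappa T) e → (Pa → η a = 0) → (Pb → η b = 0) →
      nablaIntegral T (fun t => h t * η (rho T t) + φ t * e t) a b = 0) :
    ∃ c, (∀ t ∈ kappa T, φ t = nablaIntegral T h a t + c) ∧ (¬ Pa → c = 0) ∧
      (¬ Pb → nablaIntegral T h a b + c = 0) := by
  set H := nablaIntegral T h a with hH
  have hHd : ∀ t ∈ kappa T, HasNablaDerivAt T H (h t) t :=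
    fun t ht => hT.hasNablaDerivAt_nablaIntegral hh ht
  have hHc := hT.continuousOn_of_hasNablaDerivAt hHd
  have hHld : LdContinuousOn T (kappa T) H :=
    ldContinuousOn_of_continuousOn (hHc.mono kappa_subset)
  have hHa : H a = 0 := intervalIntegral.integral_same
  have haI : a ∈ Icc a b := left_mem_Icc.2 hT.lt.le
  have hbI : b ∈ Icc a b := right_mem_Icc.2 hT.lt.le
  have hsub : ∀ {u v : ℝ → ℝ}, LdContinuousOn T (kappa T) u → LdContinuousOn T (kappa T) v →
      nablaIntegral T (fun t => u t - v t) a b = nablaIntegral T u a b - nablaIntegral T v a b :=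
    fun hu hv => intervalIntegral.integral_sub (hT.intervalIntegrable_comp_ceilPt hu haI hbI)
      (hT.intervalIntegrable_comp_ceilPt hv haI hbI)
  -- Integration by parts through `(H η)^∇ = h η^ρ + H η^∇`; the boundary term at `a` drops out
  -- since `H a = 0`.
  have hvar' : ∀ η e : ℝ → ℝ, (∀ t ∈ kappa T, HasNablaDerivAt T η (e t) t) →
      LdContinuousOn T (kappa T) e → (Pa → η a = 0) → (Pb → η b = 0) →
      nablaIntegral T (fun t => (φ t - H t) * e t) a b = - (H b * η b) := by
    intro η e hη he ha hb
    have hηρ := hT.ldContinuousOn_comp_rho (hT.continuousOn_of_hasNablaDerivAt hη)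
    have h1 := hT.nablaIntegral_eq_sub (fun t ht => (hHd t ht).mul (hη t ht) ht.1)
      ((hh.mul hηρ).add (hHld.mul he))
    have h2 := hsub ((hh.mul hηρ).add (hφ.mul he)) ((hh.mul hηρ).add (hHld.mul he))
    rw [h1, hvar η e hη he ha hb, hHa] at h2
    rw [hT.nablaIntegral_congr (h := fun t => h t * η (rho T t) + φ t * e t
      - (h t * η (rho T t) + H t * e t)) fun t _ => by ring, h2]
    ring
  have hba : b - a ≠ 0 := (sub_pos.2 hT.lt).ne'
  have hconst : ∀ c : ℝ, nablaIntegral T (fun _ => c) a b = (b - a) * c := fun c => by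
    simp [nablaIntegral]
  -- The mean of `φ - H`. Subtracting it makes the primitive of `g` vanish at both ends, so it is an
  -- allowed variation whatever the end-point conditions.
  set c := nablaIntegral T (fun t => φ t - H t) a b / (b - a) with hc
  have hcld : LdContinuousOn T (kappa T) fun _ => c := ldContinuousOn_of_continuousOn
    continuousOn_const
  have hDld := hφ.sub hHld
  have hgld := hDld.sub hcld
  set g := fun t => φ t - H t - c with hg
  have hgint : nablaIntegral T g a b = 0 := by
    rw [hg, hsub hDld hcld, hconst, hc, mul_div_cancel₀ _ hba, sub_self]
  have hsq : nablaIntegral T (fun t => g t * g t) a b = 0 := by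
    have h1 := hvar' (nablaIntegral T g a) g (fun t ht => hT.hasNablaDerivAt_nablaIntegral hgld ht)
      hgld (fun _ => intervalIntegral.integral_same) (fun _ => hgint)
    rw [hgint] at h1
    have h2 := hsub (hDld.mul hgld) (hcld.mul hgld)
    have h3 : nablaIntegral T (fun t => c * g t) a b = c * nablaIntegral T g a b :=
      intervalIntegral.integral_const_mul _ _
    rw [h1, h3, hgint] at h2
    rw [hT.nablaIntegral_congr (h := fun t => (φ t - H t) * g t - c * g t)
      fun t _ => by simp only [hg]; ring, h2]
    ring
  have hφH : ∀ t ∈ kappa T, φ t - H t = c := fun t ht => by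
    have := hT.eq_zero_of_nablaIntegral_sq hgld hsq ht
    simp only [hg] at this
    linarith
  -- Affine variations `p + d t`, used below as `b - t` when `a` is free and as `t - a` when `b` is
  -- free.
  have hlin : ∀ p d : ℝ, (Pa → p + d * a = 0) → (Pb → p + d * b = 0) →
      (b - a) * (c * d) = - (H b * (p + d * b)) := fun p d h1 h2 => by
    rw [← hvar' (fun t => p + d * t) (fun _ => d) (fun t ht => hasNablaDerivAt_linear ht.1 p d)
      (ldContinuousOn_of_continuousOn continuousOn_const) h1 h2, ← hconst (c * d)]
    exact hT.nablaIntegral_congr fun t ht => by rw [hφH t ht]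
  refine ⟨c, fun t ht => by linarith [hφH t ht], fun hPa => ?_, fun hPb => ?_⟩
  · have := hlin b (-1) (fun h => absurd h hPa) (fun _ => by ring)
    have h' : (b - a) * c = 0 := by linarith
    exact (mul_eq_zero.1 h').resolve_left hba
  · have := hlin (-a) 1 (fun _ => by ring) (fun h => absurd h hPb)
    have h' : (b - a) * (H b + c) = 0 := by linarith
    exact (mul_eq_zero.1 h').resolve_left hba

end SpansInterval

end

/-! ### Stationarity for the quotient of two functionals. -/

section

variable {T : Set ℝ} {a b t : ℝ} {f₁ f₂ : ℝ → ℝ → ℝ → ℝ} {x₀ x η e : ℝ → ℝ}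

namespace SpansInterval

theorem normC1_const_mul_le (hT : SpansInterval T a b)
    (hη : ∀ t ∈ kappa T, HasNablaDerivAt T η (e t) t) {N E : ℝ} (hN : ∀ t ∈ T, |η t| ≤ N)
    (hE : ∀ t ∈ kappa T, |e t| ≤ E) (ε : ℝ) :
    normC1 T (fun t => ε * η t) ≤ |ε| * N + |ε| * E := by
  refine add_le_add (csSup_le ⟨_, mem_image_of_mem _ hT.isLeast.1⟩ ?_) (csSup_le
    ⟨_, mem_image_of_mem _ (hT.mem_kappa_of_lt hT.isGreatest.1 hT.lt)⟩ ?_)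
  · rintro _ ⟨t, ht, rfl⟩
    simp only [abs_mul]
    exact mul_le_mul_of_nonneg_left (hN _ (rho_mem hT.isClosed ht)) (abs_nonneg _)
  · rintro _ ⟨t, ht, rfl⟩
    simp only [hT.nablaDeriv_eq ht ((hη t ht).const_mul ht.1 ε), abs_mul]
    exact mul_le_mul_of_nonneg_left (hE _ ht) (abs_nonneg _)

theorem eventually_normC1_lt (hT : SpansInterval T a b)
    (hη : ∀ t ∈ kappa T, HasNablaDerivAt T η (e t) t) (he : LdContinuousOn T (kappa T) e)
    (x : ℝ → ℝ) {δ : ℝ} (hδ : 0 < δ) :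
    ∀ᶠ ε : ℝ in 𝓝 0, normC1 T ((fun t => x t + ε * η t) - x) < δ := by
  obtain ⟨N, hN⟩ := hT.isCompact.exists_bound_of_continuousOn
    (hT.continuousOn_of_hasNablaDerivAt hη)
  obtain ⟨E, hE⟩ := hT.exists_bound he
  have hc : Tendsto (fun ε : ℝ => |ε| * N + |ε| * E) (𝓝 0) (𝓝 0) := by
    have : Continuous fun ε : ℝ => |ε| * N + |ε| * E := by fun_prop
    simpa using this.tendsto 0
  filter_upwards [hc.eventually_lt_const hδ] with ε hε
  have : (fun t => x t + ε * η t) - x = fun t => ε * η t := by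
    funext t
    simp
  rw [this]
  exact (hT.normC1_const_mul_le hη hN hE ε).trans_lt hε

/-- The first variation of a quotient of two nabla functionals vanishes at a weak local solution. -/
theorem variation_eq_zero (hT : SpansInterval T a b) (hf₁ : IsLagrangian T f₁)
    (hf₂ : IsLagrangian T f₂) {xa xb : Option ℝ}
    (hx₀ : IsWeakLocalMinimizer T (quotientAdmissible T a b f₂ xa xb)
        (fun x => functional T a b f₁ x / functional T a b f₂ x) x₀ ∨
      IsWeakLocalMaximizer T (quotientAdmissible T a b f₂ xa xb)
        (fun x => functional T a b f₁ x / functional T a b f₂ x) x₀)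
    {Q : ℝ} (hQ : Q = functional T a b f₁ x₀ / functional T a b f₂ x₀)
    (hη : ∀ t ∈ kappa T, HasNablaDerivAt T η (e t) t) (he : LdContinuousOn T (kappa T) e)
    (hηa : xa ≠ none → η a = 0) (hηb : xb ≠ none → η b = 0) :
    nablaIntegral T (fun t =>
      (along T (partialY f₁) x₀ t - Q * along T (partialY f₂) x₀ t) * η (rho T t)
      + (along T (partialV f₁) x₀ t - Q * along T (partialV f₂) x₀ t) * e t) a b = 0 := by
  have hadm : x₀ ∈ quotientAdmissible T a b f₂ xa xb := hx₀.elim (fun h => h.1) fun h => h.1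
  obtain ⟨hx, hxa, hxb, hne⟩ := hadm
  have hx0 : (fun t => x₀ t + 0 * η t) = x₀ := by simp
  have hF₁ := hT.hasDerivAt_functional hf₁ hx hη he
  have hF₂ := hT.hasDerivAt_functional hf₂ hx hη he
  have hev : ∀ᶠ ε : ℝ in 𝓝 0, (fun t => x₀ t + ε * η t) ∈ quotientAdmissible T a b f₂ xa xb := by
    -- The denominator is continuous in `ε`, so small variations remain admissible.
    have h1 : ∀ᶠ ε : ℝ in 𝓝 0, functional T a b f₂ (fun t => x₀ t + ε * η t) ≠ 0 :=
      hF₂.continuousAt.eventually_ne (by rwa [hx0])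
    filter_upwards [h1] with ε hε
    refine ⟨hT.isC1ld_add_mul hx hη he ε, fun c hc => ?_, fun c hc => ?_, hε⟩
    · simp only
      rw [hηa (fun h => by simp [h] at hc), mul_zero, add_zero, hxa c hc]
    · simp only
      rw [hηb (fun h => by simp [h] at hc), mul_zero, add_zero, hxb c hc]
  have hext : IsLocalExtr (fun ε => functional T a b f₁ (fun t => x₀ t + ε * η t)
      / functional T a b f₂ (fun t => x₀ t + ε * η t)) 0 := by
    rcases hx₀ with ⟨_, δ, hδ, hmin⟩ | ⟨_, δ, hδ, hmax⟩
    · refine Or.inl ?_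
      filter_upwards [hev, hT.eventually_normC1_lt hη he x₀ hδ] with ε h1 h2
      simpa only [hx0] using hmin _ h1 h2
    · refine Or.inr ?_
      filter_upwards [hev, hT.eventually_normC1_lt hη he x₀ hδ] with ε h1 h2
      simpa only [hx0] using hmax _ h1 h2
  have h0 := hext.hasDerivAt_eq_zero (hF₁.div hF₂ (by rwa [hx0]))
  simp only [hx0] at h0
  -- Only the numerator `𝓕₁' 𝓕₂ - 𝓕₁ 𝓕₂'` of the quotient rule survives; dividing it by `𝓕₂`
  -- produces the factor `Q`.
  rw [div_eq_zero_iff, or_iff_left (pow_ne_zero 2 hne)] at h0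
  have hηρ := hT.ldContinuousOn_comp_rho (hT.continuousOn_of_hasNablaDerivAt hη)
  have haI : a ∈ Icc a b := left_mem_Icc.2 hT.lt.le
  have hbI : b ∈ Icc a b := right_mem_Icc.2 hT.lt.le
  have hint : ∀ f, IsLagrangian T f → IntervalIntegrable (fun s => (fun t =>
      along T (partialY f) x₀ t * η (rho T t) + along T (partialV f) x₀ t * e t) (ceilPt T s))
      MeasureTheory.volume a b := fun f hf => hT.intervalIntegrable_comp_ceilPt
    (((hf.ldContinuous_y x₀ hx).mul hηρ).add ((hf.ldContinuous_v x₀ hx).mul he)) haI hbI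
  have hlin : nablaIntegral T (fun t =>
      (along T (partialY f₁) x₀ t * η (rho T t) + along T (partialV f₁) x₀ t * e t)
      - Q * (along T (partialY f₂) x₀ t * η (rho T t) + along T (partialV f₂) x₀ t * e t)) a b
      = nablaIntegral T (fun t => along T (partialY f₁) x₀ t * η (rho T t)
          + along T (partialV f₁) x₀ t * e t) a b
        - Q * nablaIntegral T (fun t => along T (partialY f₂) x₀ t * η (rho T t)
          + along T (partialV f₂) x₀ t * e t) a b := by
    have h1 := intervalIntegral.integral_sub (hint f₁ hf₁) ((hint f₂ hf₂).const_mul Q)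
    rwa [intervalIntegral.integral_const_mul] at h1
  refine (Eq.trans (hT.nablaIntegral_congr fun t _ => ?_) hlin).trans ?_
  · ring
  rw [hQ, sub_eq_zero, div_mul_eq_mul_div, eq_div_iff hne]
  linarith

end SpansInterval

end

end TimeScale

end

/-- The time scale of the problem is `I = [a, b] ∩ 𝕋`. If `a` is right-scattered then `x₀^∇ (a)`
is not defined and `f₁ᵥ - Q f₂ᵥ` along `x₀` is a function on `I_κ = I \ {a}` only; the function `φ`
extends it to `a`. If `a` is right-dense then `I_κ = I` and `φ` is that function itself. -/
theorem mainTheorem3 (𝕋 : Set ℝ) (h𝕋 : IsClosed 𝕋) (a b : ℝ) (ha : a ∈ 𝕋) (hb : b ∈ 𝕋)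
    (hab : a < b) (I : Set ℝ) (hI : I = 𝕋 ∩ Icc a b) (f₁ f₂ : ℝ → ℝ → ℝ → ℝ)
    (hf₁ : TimeScale.IsLagrangian I f₁) (hf₂ : TimeScale.IsLagrangian I f₂)
    (xa xb : Option ℝ) (x₀ : ℝ → ℝ)
    (hx₀ :
      TimeScale.IsWeakLocalMinimizer I (TimeScale.quotientAdmissible I a b f₂ xa xb)
        (fun x => TimeScale.functional I a b f₁ x / TimeScale.functional I a b f₂ x) x₀ ∨
      TimeScale.IsWeakLocalMaximizer I (TimeScale.quotientAdmissible I a b f₂ xa xb)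
        (fun x => TimeScale.functional I a b f₁ x / TimeScale.functional I a b f₂ x) x₀)
    (Q : ℝ) (hQ : Q = TimeScale.functional I a b f₁ x₀ / TimeScale.functional I a b f₂ x₀) :
    (∃ φ : ℝ → ℝ,
      (∀ t ∈ TimeScale.kappa I,
        φ t = TimeScale.along I (TimeScale.partialV f₁) x₀ t
          - Q * TimeScale.along I (TimeScale.partialV f₂) x₀ t) ∧
      (∀ t ∈ TimeScale.kappa I,
        TimeScale.HasNablaDerivAt I φ
          (TimeScale.along I (TimeScale.partialY f₁) x₀ t
            - Q * TimeScale.along I (TimeScale.partialY f₂) x₀ t) t)) ∧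
    (xa = none →
      TimeScale.nablaIntegral I (TimeScale.along I (TimeScale.partialY f₁) x₀)
          a (TimeScale.sigma I a)
        - TimeScale.along I (TimeScale.partialV f₁) x₀ (TimeScale.sigma I a)
        - Q * (TimeScale.nablaIntegral I (TimeScale.along I (TimeScale.partialY f₂) x₀)
            a (TimeScale.sigma I a)
          - TimeScale.along I (TimeScale.partialV f₂) x₀ (TimeScale.sigma I a)) = 0) ∧
    (xb = none →
      TimeScale.along I (TimeScale.partialV f₁) x₀ b
        - Q * TimeScale.along I (TimeScale.partialV f₂) x₀ b = 0) := by
  have hT : TimeScale.SpansInterval I a b := by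
    subst hI
    exact ⟨h𝕋.inter isClosed_Icc, ⟨⟨ha, left_mem_Icc.2 hab.le⟩, fun t ht => ht.2.1⟩,
      ⟨⟨hb, right_mem_Icc.2 hab.le⟩, fun t ht => ht.2.2⟩, hab⟩
  have hx : TimeScale.IsC1ld I x₀ := hx₀.elim (fun h => h.1.1) fun h => h.1.1
  have hy₁ := hf₁.ldContinuous_y x₀ hx
  have hy₂ := (hf₂.ldContinuous_y x₀ hx).const_mul Q
  have hh := hy₁.sub hy₂
  have hφ := (hf₁.ldContinuous_v x₀ hx).sub ((hf₂.ldContinuous_v x₀ hx).const_mul Q)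
  obtain ⟨c, hc, hca, hcb⟩ := hT.dubois_reymond hh hφ (Pa := xa ≠ none) (Pb := xb ≠ none)
    fun η e hη he => hT.variation_eq_zero hf₁ hf₂ hx₀ hQ hη he
  -- The witness `H + c` is defined on all of `I`; at a right-scattered `a` it supplies the value
  -- `φ(a) = c`.
  refine ⟨⟨fun t => TimeScale.nablaIntegral I (fun t =>
    TimeScale.along I (TimeScale.partialY f₁) x₀ t
      - Q * TimeScale.along I (TimeScale.partialY f₂) x₀ t) a t + c,
    fun t ht => (hc t ht).symm, fun t ht => ?_⟩, fun hxa => ?_, fun hxb => ?_⟩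
  · simpa using (hT.hasNablaDerivAt_nablaIntegral hh ht).add
      (TimeScale.hasNablaDerivAt_linear ht.1 c 0) ht.1
  · have hσ := TimeScale.sigma_mem hT.isClosed hT.isLeast.1
    -- Condition (2) is `φ = H + c` at `σ(a)` with `c = 0`. The point `σ(a)` lies in `I_κ` whether
    -- `a` is right-scattered or right-dense.
    have hσk : TimeScale.sigma I a ∈ TimeScale.kappa I := by
      rcases (TimeScale.le_sigma I a).lt_or_eq with h | h
      · exact hT.mem_kappa_of_lt hσ h
      · exact hT.mem_kappa_iff.2 ⟨hσ, Or.inr ⟨h.symm, h.symm⟩⟩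
    have haI : a ∈ Icc a b := left_mem_Icc.2 hab.le
    have hσI : TimeScale.sigma I a ∈ Icc a b := ⟨hT.isLeast.2 hσ, hT.isGreatest.2 hσ⟩
    have hlin : TimeScale.nablaIntegral I (fun t => TimeScale.along I (TimeScale.partialY f₁) x₀ t
          - Q * TimeScale.along I (TimeScale.partialY f₂) x₀ t) a (TimeScale.sigma I a)
        = TimeScale.nablaIntegral I (TimeScale.along I (TimeScale.partialY f₁) x₀)
            a (TimeScale.sigma I a)
          - Q * TimeScale.nablaIntegral I (TimeScale.along I (TimeScale.partialY f₂) x₀)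
            a (TimeScale.sigma I a) := by
      have h1 := intervalIntegral.integral_sub (hT.intervalIntegrable_comp_ceilPt hy₁ haI hσI)
        (hT.intervalIntegrable_comp_ceilPt hy₂ haI hσI)
      rwa [intervalIntegral.integral_const_mul] at h1
    have h1 := hc _ hσk
    rw [hca (not_not.2 hxa), add_zero, hlin] at h1
    linarith
  · have h1 := hc b (hT.mem_kappa_of_lt hT.isGreatest.1 hab)
    rw [hcb (not_not.2 hxb)] at h1
    exact h1
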